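/- Let $K\subset\mathbb C$ be a convex domain, i.e. a compact convex set with nonempty interior, and let $\kappa>0$. Fix an interior point $z$ of $K$ and let $\gamma(\varphi)$, $\varphi\in\mathbb R$, be the unique point of $\Gamma=\partial K$ on the ray $\{z+te^{i\varphi}:t>0\}$; thus $\gamma$ is a $2\pi$-periodic counterclockwise parametrization of $\Gamma$. Define the right and left tangent angles by $$\alpha_+(\theta)=\inf_{\theta<\psi<\theta+\pi}\arg\bigl(\gamma(\psi)-\gamma(\theta)\bigr),\qquad \alpha_-(\theta)=\sup_{\theta-\pi<\psi<\theta}\arg\bigl(\gamma(\theta)-\gamma(\psi)\bigr),$$ where the arguments are taken in $(\theta,\theta+\pi)$. Let $a$ be the length of $\Gamma$ and $s$ the arc length measured from $\gamma(0)$; write $\alpha_\pm(s)$ for $\alpha_\pm$ as functions of $s$, and put $\alpha=(\alpha_++\alpha_-)/2$. Then the following conditions are equivalent: 1. for almost every $s\in[0,a]$ the curvature $\alpha'(s)$ exists and $\alpha'(s)\ge\kappa$; 2. for almost every $s\in[0,a]$ the radius of curvature $\rho(s)=1/\alpha'(s)\in[0,\infty]$ exists and $\rho(s)\le 1/\kappa$;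 3. $\alpha_+(y)-\alpha_+(x)\ge\kappa(y-x)$ and $\alpha_-(y)-\alpha_-(x)\ge\kappa(y-x)$ whenever $0\le x\le y\le a$ (arc length parameters); 4. (subdifferential condition) $|\alpha_\pm(\eta)-\alpha_\pm(\zeta)|\ge\kappa\,|\Gamma(\eta,\zeta)|$ for both signs and for every arc $\Gamma(\eta,\zeta)$ of $\Gamma$, where $|\Gamma(\eta,\zeta)|$ is its length; that is, for all $\varphi\le\psi\le\varphi+2\pi$ (polar parameters), $|\alpha_\pm(\psi)-\alpha_\pm(\varphi)|$ is at least $\kappa$ times the length of $\gamma|_{[\varphi,\psi]}$. If one (hence each) of these conditions holds, then for every integer $n\ge 0$ and every complex polynomial $p$ of degree exactly $n$ having all its zeros in $K$, $$\max_K|p'|\ \ge\ \frac{\kappa}{2}\,n\,\max_K|p| .$$ -/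

import Mathlib

open Set MeasureTheory Polynomial

noncomputable section

/-- A convex domain: a compact convex subset of the plane with nonempty interior. -/
def IsConvexDomain (K : Set ℂ) : Prop :=
  IsCompact K ∧ Convex ℝ K ∧ (interior K).Nonempty

/-- The parameter `t > 0` of the (unique) point of `∂K` on the open ray from the interior
point `z` in the direction `e ^ (i φ)`. -/
def radialFunction (K : Set ℂ) (z : ℂ) (φ : ℝ) : ℝ :=
  sSup {t : ℝ | 0 < t ∧ z + (t : ℂ) * Complex.exp ((φ : ℂ) * Complex.I) ∈ frontier K}

/-- The `2π`-periodic, counterclockwise parametrization of `∂K` by the polar angle about the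
interior point `z`: `γ φ` is the point of `∂K` on the ray `z + t e ^ (i φ)`, `t > 0`. -/
def boundaryCurve (K : Set ℂ) (z : ℂ) (φ : ℝ) : ℂ :=
  z + (radialFunction K z φ : ℂ) * Complex.exp ((φ : ℂ) * Complex.I)

/-- The right tangent angle `α₊` at `γ θ`: the infimum of the arguments of the chords from `γ θ`
to the boundary points following it. After rotation by `e ^ (-i θ)` the chords to `γ ψ`,
`θ < ψ < θ + π`, lie in the open upper half plane, so their principal arguments lie in `(0, π)`.
Adding `θ` back gives the branch which increases by `2π` along each turn around `K`. -/
def tangentAngleRight (K : Set ℂ) (z : ℂ) (θ : ℝ) : ℝ :=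
  θ + sInf ((fun ψ : ℝ => Complex.arg ((boundaryCurve K z ψ - boundaryCurve K z θ) *
    Complex.exp (-(θ : ℂ) * Complex.I))) '' Ioo θ (θ + Real.pi))

/-- The left tangent angle `α₋` at `γ θ`: the supremum of the arguments of the chords to `γ θ`
from the boundary points preceding it, with the same branch as for `α₊`. -/
def tangentAngleLeft (K : Set ℂ) (z : ℂ) (θ : ℝ) : ℝ :=
  θ + sSup ((fun ψ : ℝ => Complex.arg ((boundaryCurve K z θ - boundaryCurve K z ψ) *
    Complex.exp (-(θ : ℂ) * Complex.I))) '' Ioo (θ - Real.pi) θ)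

/-- Length of the arc of `∂K` traversed by `γ` on the parameter interval `[φ, ψ]`. -/
def arcLength (K : Set ℂ) (z : ℂ) (φ ψ : ℝ) : ℝ :=
  (eVariationOn (boundaryCurve K z) (Icc φ ψ)).toReal

/-- The length `a` of the whole boundary curve. -/
def perimeter (K : Set ℂ) (z : ℂ) : ℝ :=
  arcLength K z 0 (2 * Real.pi)

/-- The polar angle as a function of arc length: the inverse of the signed arc length of `γ`
measured from `γ 0`. -/
def angleOfArcLength (K : Set ℂ) (z : ℂ) : ℝ → ℝ :=
  Function.invFun (variationOnFromTo (boundaryCurve K z) univ 0)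

/-- `α₊` as a function of arc length. -/
def alphaPlus (K : Set ℂ) (z : ℂ) (s : ℝ) : ℝ :=
  tangentAngleRight K z (angleOfArcLength K z s)

/-- `α₋` as a function of arc length. -/
def alphaMinus (K : Set ℂ) (z : ℂ) (s : ℝ) : ℝ :=
  tangentAngleLeft K z (angleOfArcLength K z s)

/-- The tangent angle `α = (α₊ + α₋) / 2` as a function of arc length. -/
def tangentAngle (K : Set ℂ) (z : ℂ) (s : ℝ) : ℝ :=
  (alphaPlus K z s + alphaMinus K z s) / 2

/-- The curvature `κ(s) = α'(s)` (meaningful where `α` is differentiable). -/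
def curvature (K : Set ℂ) (z : ℂ) (s : ℝ) : ℝ :=
  deriv (tangentAngle K z) s

/-- The radius of curvature `1 / κ(s) ∈ [0, ∞]`, equal to `∞` where the curvature vanishes. -/
def curvatureRadius (K : Set ℂ) (z : ℂ) (s : ℝ) : ENNReal :=
  (ENNReal.ofReal (curvature K z s))⁻¹

/-- The curvature exists and is at least `l` at almost every arc length parameter. -/
def CurvatureGeAE (K : Set ℂ) (z : ℂ) (l : ℝ) : Prop :=
  ∀ᵐ s ∂(volume.restrict (Icc 0 (perimeter K z))),
    DifferentiableAt ℝ (tangentAngle K z) s ∧ l ≤ curvature K z s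

/-- The radius of curvature exists and is at most `1 / l` at almost every arc length
parameter. -/
def CurvatureRadiusLeAE (K : Set ℂ) (z : ℂ) (l : ℝ) : Prop :=
  ∀ᵐ s ∂(volume.restrict (Icc 0 (perimeter K z))),
    DifferentiableAt ℝ (tangentAngle K z) s ∧ curvatureRadius K z s ≤ (ENNReal.ofReal l)⁻¹

/-- `α±(y) - α±(x) ≥ l (y - x)` for all arc length parameters `x ≤ y` in `[0, a]`. -/
def AngleIncrementGe (K : Set ℂ) (z : ℂ) (l : ℝ) : Prop :=
  ∀ x ∈ Icc 0 (perimeter K z), ∀ y ∈ Icc 0 (perimeter K z), x ≤ y →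
    l * (y - x) ≤ alphaPlus K z y - alphaPlus K z x ∧
    l * (y - x) ≤ alphaMinus K z y - alphaMinus K z x

/-- The subdifferential condition `|α±(η) - α±(ζ)| ≥ l |Γ(η, ζ)|` for every arc of the boundary
curve, from `ζ = γ φ` to `η = γ ψ`, where `φ ≤ ψ ≤ φ + 2π`. -/
def SubdifferentialCondition (K : Set ℂ) (z : ℂ) (l : ℝ) : Prop :=
  ∀ φ ψ : ℝ, φ ≤ ψ → ψ ≤ φ + 2 * Real.pi →
    l * arcLength K z φ ψ ≤ |tangentAngleRight K z ψ - tangentAngleRight K z φ| ∧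
    l * arcLength K z φ ψ ≤ |tangentAngleLeft K z ψ - tangentAngleLeft K z φ|

/-- The class `P_n(K)` of complex polynomials of degree exactly `n`, all of whose zeros lie
in `K`. -/
def polynomialsWithZerosIn (n : ℕ) (K : Set ℂ) : Set ℂ[X] :=
  {p | p.degree = (n : WithBot ℕ) ∧ ∀ w : ℂ, p.IsRoot w → w ∈ K}

/-- The maximum norm of a polynomial on `K`. -/
def supNormOn (K : Set ℂ) (p : ℂ[X]) : ℝ :=
  sSup ((fun w : ℂ => ‖p.eval w‖) '' K)

end

/-!
The equivalences rest on monotonicity of the tangent angles: `α₋(θ) ≤ α₊(θ) ≤ α₋(ψ)` for `θ < ψ`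
(`tangentAngleLeft_le_tangentAngleRight`, `tangentAngleRight_le_tangentAngleLeft`). The first
inequality holds because the angle of any supporting line at `γ θ` lies between the two, the second
because both sides are compared with the angle of the chord from `γ θ` to `γ ψ`. The boundary curve
is Lipschitz (its radial function is the inverse of a gauge), so arc length is a strictly increasing
continuous function of the polar angle and `α` is a monotone function of arc length. A monotone
function grows by at least the integral of its derivative; applied to `α` on arcs slightly shorter
than `[x, y]`, this turns a pointwise bound on the curvature into
`κ (y - x) ≤ α₋(y) - α₊(x)`, which gives the increment condition for both `α₊` and `α₋`.

The inequality for polynomials follows from Blaschke's rolling theorem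
(`SubdifferentialCondition.exists_disc`): every frontier point `w` lies on the boundary of a disc of
radius `R = 1 / κ` which contains `K`. To prove it, let `X τ` be a point where the line of direction
`e ^ (i τ)` supports `K`. The subdifferential condition says that `X` is Lipschitz with constant `R`,
and the chord from `X τ` to `X τ'` has direction between `τ` and `τ'`. The point `X τ` hence moves,
in every fixed direction, no faster than the corresponding point of a circle of radius `R`.
Comparing the two motions bounds the support function of `K` by that of the disc. No derivative of
`X` is needed: the comparison holds up to an error quadratic in the step, and such errors
disappear on refining a subdivision (`le_of_sub_le_mul_sq`).

Finally, `|p|` attains its maximum over `K` at a frontier point `w`. If `c` is the centre of the disc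
at `w`, then each zero `r` of `p` contributes at least `1 / 2` to the real part of
`(w - c) p'(w) / p(w) = ∑ (w - c) / (w - r)`, so that `R |p'(w)| ≥ (n / 2) |p(w)|`.
-/

/-! ### The boundary curve -/

/-- In a translate with `z` at the origin, the radial function is the inverse of the Minkowski
gauge. -/
theorem radialFunction_eq_inv_gauge {K : Set ℂ} (hK : IsConvexDomain K) {z : ℂ}
    (hz : z ∈ interior K) (φ : ℝ) :
    0 < gauge ((z + ·) ⁻¹' K) (Complex.exp (φ * Complex.I)) ∧
    radialFunction K z φ = (gauge ((z + ·) ⁻¹' K) (Complex.exp (φ * Complex.I)))⁻¹ := by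
  obtain ⟨hc, hv, -⟩ := hK
  set K' := (z + ·) ⁻¹' K with hK'
  have hv' : Convex ℝ K' := hv.translate_preimage_right z
  have h0 : K' ∈ nhds (0 : ℂ) := by
    apply (continuous_const_add z).continuousAt.preimage_mem_nhds
    simpa using mem_interior_iff_mem_nhds.1 hz
  have hb : Bornology.IsBounded K' :=
    ((Homeomorph.addLeft z).isCompact_preimage.2 hc).isBounded
  have hg : 0 < gauge K' (Complex.exp (φ * Complex.I)) :=
    (gauge_pos (absorbent_nhds_zero h0) ((NormedSpace.isVonNBounded_iff ℝ).2 hb)).2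
      (Complex.exp_ne_zero _)
  refine ⟨hg, ?_⟩
  have hfr : frontier K' = (z + ·) ⁻¹' frontier K :=
    ((Homeomorph.addLeft z).preimage_frontier K).symm
  have hset : {t : ℝ | 0 < t ∧ z + (t : ℂ) * Complex.exp ((φ : ℂ) * Complex.I) ∈ frontier K} =
      {(gauge K' (Complex.exp (φ * Complex.I)))⁻¹} := by
    ext t
    have : z + (t : ℂ) * Complex.exp ((φ : ℂ) * Complex.I) ∈ frontier K ↔
        (t : ℂ) * Complex.exp ((φ : ℂ) * Complex.I) ∈ frontier K' := by rw [hfr]; rfl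
    simp only [mem_ofPred_eq, mem_singleton_iff, this, ← gauge_eq_one_iff_mem_frontier hv' h0]
    constructor
    · rintro ⟨ht, h⟩
      rw [← Complex.real_smul, gauge_smul_of_nonneg ht.le, smul_eq_mul] at h
      exact eq_inv_of_mul_eq_one_left h
    · rintro rfl
      refine ⟨inv_pos.2 hg, ?_⟩
      rw [← Complex.real_smul, gauge_smul_of_nonneg (inv_pos.2 hg).le, smul_eq_mul]
      exact inv_mul_cancel₀ hg.ne'
  rw [radialFunction, hset, csSup_singleton]

theorem radialFunction_pos {K : Set ℂ} (hK : IsConvexDomain K) {z : ℂ}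
    (hz : z ∈ interior K) (φ : ℝ) : 0 < radialFunction K z φ := by
  obtain ⟨h, h'⟩ := radialFunction_eq_inv_gauge hK hz φ
  rw [h']
  exact inv_pos.2 h

/-- Relative to an interior point `z`, the frontier is the unit level set of the gauge. -/
theorem mem_frontier_iff_gauge_sub {K : Set ℂ} (hK : IsConvexDomain K) {z : ℂ}
    (hz : z ∈ interior K) (w : ℂ) : w ∈ frontier K ↔ gauge ((z + ·) ⁻¹' K) (w - z) = 1 := by
  have h0 : (z + ·) ⁻¹' K ∈ nhds (0 : ℂ) := by
    apply (continuous_const_add z).continuousAt.preimage_mem_nhds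
    simpa using mem_interior_iff_mem_nhds.1 hz
  have hfr : frontier ((z + ·) ⁻¹' K) = (z + ·) ⁻¹' frontier K :=
    ((Homeomorph.addLeft z).preimage_frontier K).symm
  rw [gauge_eq_one_iff_mem_frontier (hK.2.1.translate_preimage_right z) h0, hfr]
  simp

theorem boundaryCurve_mem_frontier {K : Set ℂ} (hK : IsConvexDomain K) {z : ℂ}
    (hz : z ∈ interior K) (φ : ℝ) : boundaryCurve K z φ ∈ frontier K := by
  obtain ⟨h, h'⟩ := radialFunction_eq_inv_gauge hK hz φ
  rw [mem_frontier_iff_gauge_sub hK hz, boundaryCurve, add_sub_cancel_left, ← Complex.real_smul,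
    gauge_smul_of_nonneg (radialFunction_pos hK hz φ).le, h', smul_eq_mul]
  exact inv_mul_cancel₀ h.ne'

theorem boundaryCurve_mem {K : Set ℂ} (hK : IsConvexDomain K) {z : ℂ}
    (hz : z ∈ interior K) (φ : ℝ) : boundaryCurve K z φ ∈ K :=
  hK.1.isClosed.frontier_subset (boundaryCurve_mem_frontier hK hz φ)

theorem eq_boundaryCurve_of_mem_frontier {K : Set ℂ} (hK : IsConvexDomain K) {z : ℂ}
    (hz : z ∈ interior K) {w : ℂ} (hw : w ∈ frontier K) {φ ρ : ℝ} (hρ : 0 < ρ)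
    (h : w - z = ρ * Complex.exp (φ * Complex.I)) : boundaryCurve K z φ = w := by
  obtain ⟨hg, hg'⟩ := radialFunction_eq_inv_gauge hK hz φ
  rw [mem_frontier_iff_gauge_sub hK hz, h, ← Complex.real_smul,
    gauge_smul_of_nonneg hρ.le, smul_eq_mul] at hw
  rw [boundaryCurve, hg', ← eq_inv_of_mul_eq_one_left hw, ← h]
  ring

theorem boundaryCurve_add_int_mul_two_pi (K : Set ℂ) (z : ℂ) (φ : ℝ) (m : ℤ) :
    boundaryCurve K z (φ + m * (2 * Real.pi)) = boundaryCurve K z φ := by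
  have : Complex.exp (((φ + m * (2 * Real.pi) : ℝ) : ℂ) * Complex.I) =
      Complex.exp (φ * Complex.I) := by
    rw [← Complex.exp_periodic.int_mul m (φ * Complex.I)]
    push_cast
    ring_nf
  rw [boundaryCurve, boundaryCurve, radialFunction, radialFunction, this]

theorem norm_exp_mul_I_sub_le (x y : ℝ) :
    ‖Complex.exp (x * Complex.I) - Complex.exp (y * Complex.I)‖ ≤ |x - y| := by
  have := (lipschitzWith_circleMap 0 1).dist_le_mul x y
  simpa [circleMap, dist_eq_norm] using this

theorem exists_lipschitzWith_boundaryCurve {K : Set ℂ} (hK : IsConvexDomain K) {z : ℂ}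
    (hz : z ∈ interior K) : ∃ C, LipschitzWith C (boundaryCurve K z) := by
  have h0 : (z + ·) ⁻¹' K ∈ nhds (0 : ℂ) := by
    apply (continuous_const_add z).continuousAt.preimage_mem_nhds
    simpa using mem_interior_iff_mem_nhds.1 hz
  obtain ⟨L, hL⟩ := (hK.2.1.translate_preimage_right z).lipschitz_gauge h0
  obtain ⟨M, hM0, hM⟩ := hK.1.isBounded.subset_closedBall_lt 0 z
  have hr : ∀ φ, radialFunction K z φ ≤ M := by
    intro φ
    have := hM (boundaryCurve_mem hK hz φ)
    rw [mem_closedBall_iff_norm, boundaryCurve, add_sub_cancel_left, norm_mul,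
      Complex.norm_exp_ofReal_mul_I, mul_one, Complex.norm_real] at this
    exact (le_abs_self _).trans this
  refine ⟨⟨M * M * L + M, by positivity⟩, LipschitzWith.of_dist_le_mul fun x y => ?_⟩
  obtain ⟨hx, hx'⟩ := radialFunction_eq_inv_gauge hK hz x
  obtain ⟨hy, hy'⟩ := radialFunction_eq_inv_gauge hK hz y
  have hrr : |radialFunction K z x - radialFunction K z y| ≤ M * M * (L * |x - y|) := by
    have e : radialFunction K z x - radialFunction K z y =
        radialFunction K z x * radialFunction K z y *
          (gauge ((z + ·) ⁻¹' K) (Complex.exp (y * Complex.I)) -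
            gauge ((z + ·) ⁻¹' K) (Complex.exp (x * Complex.I))) := by
      rw [hx', hy', inv_sub_inv hx.ne' hy.ne', div_eq_mul_inv, mul_inv]
      ring
    have hg := hL.dist_le_mul (Complex.exp (y * Complex.I)) (Complex.exp (x * Complex.I))
    rw [Real.dist_eq, dist_eq_norm] at hg
    have h1 := norm_exp_mul_I_sub_le y x
    rw [abs_sub_comm] at h1
    have px := radialFunction_pos hK hz x
    have py := radialFunction_pos hK hz y
    rw [e, abs_mul, abs_of_pos (mul_pos px py)]
    have := hr x
    have := hr y
    gcongr
    exact hg.trans (by gcongr)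
  have e : boundaryCurve K z x - boundaryCurve K z y =
      ((radialFunction K z x - radialFunction K z y : ℝ) : ℂ) * Complex.exp (x * Complex.I) +
      (radialFunction K z y : ℂ) *
        (Complex.exp (x * Complex.I) - Complex.exp (y * Complex.I)) := by
    rw [boundaryCurve, boundaryCurve]
    push_cast
    ring
  rw [dist_eq_norm, e, Real.dist_eq]
  refine (norm_add_le _ _).trans ?_
  rw [norm_mul, norm_mul, Complex.norm_exp_ofReal_mul_I, mul_one, Complex.norm_real,
    Complex.norm_real, Real.norm_eq_abs, Real.norm_eq_abs,
    abs_of_pos (radialFunction_pos hK hz y)]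
  have h3 : radialFunction K z y * ‖Complex.exp (x * Complex.I) - Complex.exp (y * Complex.I)‖ ≤
      M * |x - y| := by
    gcongr
    exacts [hr y, norm_exp_mul_I_sub_le x y]
  change _ ≤ (M * M * L + M) * |x - y|
  linarith

/-! ### Supporting directions -/

/-- The signed distance of the vector `v` from the line through `0` in the direction `e ^ (i τ)`,
positive on the left of that line. -/
noncomputable def sideDist (τ : ℝ) (v : ℂ) : ℝ := (v * Complex.exp (-(τ : ℂ) * Complex.I)).im

theorem sideDist_eq (τ : ℝ) (v : ℂ) : sideDist τ v = v.im * Real.cos τ - v.re * Real.sin τ := by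
  simp [sideDist, Complex.mul_im, Complex.exp_re, Complex.exp_im]
  ring

theorem sideDist_polar (τ ρ ξ : ℝ) :
    sideDist τ (ρ * Complex.exp (ξ * Complex.I)) = ρ * Real.sin (ξ - τ) := by
  rw [sideDist, mul_assoc, ← Complex.exp_add, Complex.im_ofReal_mul]
  have : (ξ : ℂ) * Complex.I + -(τ : ℂ) * Complex.I = ((ξ - τ : ℝ) : ℂ) * Complex.I := by
    push_cast; ring
  rw [this, Complex.exp_ofReal_mul_I_im]

theorem sideDist_sub (τ : ℝ) (v w : ℂ) : sideDist τ (v - w) = sideDist τ v - sideDist τ w := by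
  simp only [sideDist, sub_mul, Complex.sub_im]

theorem sideDist_zero (τ : ℝ) : sideDist τ 0 = 0 := by simp [sideDist]

theorem sideDist_neg (τ : ℝ) (v : ℂ) : sideDist τ (-v) = -sideDist τ v := by
  simp [sideDist]

theorem continuous_sideDist (τ : ℝ) : Continuous (sideDist τ) := by
  unfold sideDist
  fun_prop

theorem abs_sideDist_le_norm (τ : ℝ) (v : ℂ) : |sideDist τ v| ≤ ‖v‖ := by
  refine (Complex.abs_im_le_norm _).trans_eq ?_
  rw [norm_mul, ← Complex.ofReal_neg, Complex.norm_exp_ofReal_mul_I, mul_one]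

/-- The line through `w` in the direction `e ^ (i τ)` supports `K` at `w`, with `K` on its left. -/
noncomputable def IsSupportDirection (K : Set ℂ) (τ : ℝ) (w : ℂ) : Prop :=
  w ∈ K ∧ ∀ x ∈ K, 0 ≤ sideDist τ (x - w)

theorem IsSupportDirection.sideDist_pos {K : Set ℂ} {τ : ℝ} {w z : ℂ}
    (h : IsSupportDirection K τ w) (hz : z ∈ interior K) : 0 < sideDist τ (z - w) := by
  obtain ⟨ε, hε, hb⟩ := Metric.mem_nhds_iff.1 (mem_interior_iff_mem_nhds.1 hz)
  -- move from `z` a little to the right of the line; the result is still in `K`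
  set u : ℂ := ((ε / 2 : ℝ) : ℂ) * Complex.exp ((τ + Real.pi / 2 : ℝ) * Complex.I)
  have hu : ‖u‖ = ε / 2 := by
    rw [norm_mul, Complex.norm_exp_ofReal_mul_I, mul_one, Complex.norm_real, Real.norm_eq_abs,
      abs_of_pos (by positivity)]
  have hmem : z - u ∈ K := by
    apply hb
    rw [mem_ball_iff_norm, sub_sub_cancel_left, norm_neg, hu]
    linarith
  have h1 := h.2 _ hmem
  have h2 : sideDist τ u = ε / 2 := by
    rw [sideDist_polar, add_sub_cancel_left, Real.sin_pi_div_two, mul_one]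
  rw [sub_right_comm, sideDist_sub, h2] at h1
  linarith

theorem IsSupportDirection.mem_frontier {K : Set ℂ} {τ : ℝ} {w : ℂ}
    (h : IsSupportDirection K τ w) : w ∈ frontier K := by
  refine ⟨subset_closure h.1, fun hw => ?_⟩
  have := h.sideDist_pos hw
  rw [sub_self, sideDist_zero] at this
  exact lt_irrefl _ this

/-- A compact set has a supporting line in every direction. -/
theorem exists_isSupportDirection {K : Set ℂ} (hK : IsCompact K) (hne : K.Nonempty) (τ : ℝ) :
    ∃ w, IsSupportDirection K τ w := by
  obtain ⟨w, hw, hmin⟩ := hK.exists_isMinOn hne (continuous_sideDist τ).continuousOn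
  refine ⟨w, hw, fun x hx => ?_⟩
  rw [sideDist_sub, sub_nonneg]
  exact hmin hx

/-- A convex domain has a supporting line at every frontier point. -/
theorem exists_isSupportDirection_of_mem_frontier {K : Set ℂ} (hK : IsConvexDomain K) {w : ℂ}
    (hw : w ∈ frontier K) : ∃ τ, IsSupportDirection K τ w := by
  obtain ⟨f, u, hf, hle, hge⟩ := geometric_hahn_banach_of_nonempty_interior hK.2.1
    (convex_singleton w) (disjoint_singleton_right.2 hw.2) hK.2.2 (singleton_nonempty w)
  have hge := hge w rfl
  have hfv : ∀ v : ℂ, f v = v.re * f 1 + v.im * f Complex.I := by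
    intro v
    conv_lhs => rw [show v = v.re • (1 : ℂ) + v.im • Complex.I by simp [Complex.re_add_im]]
    rw [map_add, map_smul, map_smul, smul_eq_mul, smul_eq_mul]
  set c : ℂ := ⟨-f Complex.I, f 1⟩ with hc
  refine ⟨c.arg, hK.1.isClosed.frontier_subset hw, fun x hx => ?_⟩
  have hfx : f (x - w) ≤ 0 := by
    rw [map_sub]
    linarith [hle x hx]
  have hc0 : c ≠ 0 := by
    intro h0
    apply hf
    ext v
    have h1 : f 1 = 0 := by simpa [hc] using congrArg Complex.im h0
    have h2 : f Complex.I = 0 := by simpa [hc] using congrArg Complex.re h0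
    simp [hfv v, h1, h2]
  have hcn := norm_pos_iff.2 hc0
  have h1 : f 1 = ‖c‖ * Real.sin c.arg := (Complex.norm_mul_sin_arg c).symm
  have h2 : -f Complex.I = ‖c‖ * Real.cos c.arg := (Complex.norm_mul_cos_arg c).symm
  have h3 : f (x - w) = -(‖c‖ * sideDist c.arg (x - w)) := by
    rw [hfv, sideDist_eq, h1, ← neg_neg (f Complex.I), h2]
    ring
  rw [h3] at hfx
  exact (mul_nonneg_iff_of_pos_left hcn).1 (by linarith)

/-! ### Angles of chords -/

/-- The argument of `v` on the branch `(θ, θ + π)`, for `v` on the left of the line with direction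
`e ^ (i θ)`. -/
noncomputable def chordAngle (θ : ℝ) (v : ℂ) : ℝ :=
  θ + Complex.arg (v * Complex.exp (-(θ : ℂ) * Complex.I))

theorem eq_norm_mul_exp_chordAngle (θ : ℝ) (v : ℂ) :
    v = ‖v‖ * Complex.exp (chordAngle θ v * Complex.I) := by
  have h := Complex.norm_mul_exp_arg_mul_I (v * Complex.exp (-(θ : ℂ) * Complex.I))
  rw [norm_mul, ← Complex.ofReal_neg, Complex.norm_exp_ofReal_mul_I, mul_one] at h
  have e : (chordAngle θ v : ℂ) * Complex.I = θ * Complex.I +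
      Complex.arg (v * Complex.exp (((-θ : ℝ) : ℂ) * Complex.I)) * Complex.I := by
    rw [chordAngle]
    push_cast
    ring
  rw [e, Complex.exp_add, mul_left_comm, h, mul_left_comm, ← Complex.exp_add]
  simp

theorem chordAngle_mem_Ioo {θ : ℝ} {v : ℂ} (h : 0 < sideDist θ v) :
    chordAngle θ v ∈ Ioo θ (θ + Real.pi) := by
  have h1 : 0 < (v * Complex.exp (-(θ : ℂ) * Complex.I)).arg := by
    refine lt_of_le_of_ne (Complex.arg_nonneg_iff.2 h.le) fun h0 => ?_
    exact h.ne' (Complex.arg_eq_zero_iff.1 h0.symm).2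
  have h2 : (v * Complex.exp (-(θ : ℂ) * Complex.I)).arg < Real.pi :=
    Complex.arg_lt_pi_iff.2 (Or.inr h.ne')
  constructor <;> unfold chordAngle <;> linarith

theorem ne_zero_of_sideDist_pos {θ : ℝ} {v : ℂ} (h : 0 < sideDist θ v) : v ≠ 0 := by
  rintro rfl
  rw [sideDist_zero] at h
  exact lt_irrefl _ h

theorem sideDist_eq_norm_mul_sin (θ τ : ℝ) (v : ℂ) :
    sideDist τ v = ‖v‖ * Real.sin (chordAngle θ v - τ) := by
  conv_lhs => rw [eq_norm_mul_exp_chordAngle θ v, sideDist_polar]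

theorem le_chordAngle {θ τ : ℝ} {v : ℂ} (h : 0 < sideDist θ v) (hτ : τ ∈ Ioo θ (θ + Real.pi))
    (hv : 0 ≤ sideDist τ v) : τ ≤ chordAngle θ v := by
  have hn := norm_pos_iff.2 (ne_zero_of_sideDist_pos h)
  rw [sideDist_eq_norm_mul_sin θ, mul_nonneg_iff_of_pos_left hn] at hv
  have hA := chordAngle_mem_Ioo h
  by_contra! hlt
  have := Real.sin_neg_of_neg_of_neg_pi_lt (x := chordAngle θ v - τ) (by linarith)
    (by linarith [hA.1, hτ.2])
  linarith

theorem chordAngle_le {θ τ : ℝ} {v : ℂ} (h : 0 < sideDist θ v) (hτ : τ ∈ Ioo θ (θ + Real.pi))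
    (hv : sideDist τ v ≤ 0) : chordAngle θ v ≤ τ := by
  have hn := norm_pos_iff.2 (ne_zero_of_sideDist_pos h)
  have hA := chordAngle_mem_Ioo h
  by_contra! hlt
  have := Real.sin_pos_of_pos_of_lt_pi (x := chordAngle θ v - τ) (by linarith)
    (by linarith [hA.2, hτ.1])
  have := mul_pos hn this
  rw [← sideDist_eq_norm_mul_sin θ] at this
  linarith

/-- The branches of the argument attached to two base angles agree where both are used. -/
theorem chordAngle_eq_chordAngle {θ ψ : ℝ} (h1 : θ ≤ ψ) (h2 : ψ < θ + Real.pi) {v : ℂ}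
    (hθ : 0 < sideDist θ v) (hψ : 0 < sideDist ψ v) : chordAngle θ v = chordAngle ψ v := by
  have hn := norm_pos_iff.2 (ne_zero_of_sideDist_pos hθ)
  have hA := chordAngle_mem_Ioo hθ
  have hB := chordAngle_mem_Ioo hψ
  have hB' : chordAngle ψ v < θ + Real.pi := by
    by_contra! hge
    rw [sideDist_eq_norm_mul_sin ψ θ, mul_pos_iff_of_pos_left hn] at hθ
    have := Real.sin_nonneg_of_nonneg_of_le_pi (x := chordAngle ψ v - θ - Real.pi) (by linarith)
      (by linarith [hB.2])
    rw [Real.sin_sub_pi] at this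
    linarith
  have h0 : sideDist (chordAngle ψ v) v = 0 := by
    rw [sideDist_eq_norm_mul_sin ψ, sub_self, Real.sin_zero, mul_zero]
  have hB'' : chordAngle ψ v ∈ Ioo θ (θ + Real.pi) := ⟨h1.trans_lt hB.1, hB'⟩
  exact le_antisymm (chordAngle_le hθ hB'' h0.le) (le_chordAngle hθ hB'' h0.ge)

theorem sideDist_boundaryCurve_sub (K : Set ℂ) (z : ℂ) (θ ψ τ : ℝ) :
    sideDist τ (boundaryCurve K z ψ - boundaryCurve K z θ) =
      radialFunction K z ψ * Real.sin (ψ - τ) - radialFunction K z θ * Real.sin (θ - τ) := by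
  rw [boundaryCurve, boundaryCurve, add_sub_add_left_eq_sub, sideDist_sub, sideDist_polar,
    sideDist_polar]

section

variable {K : Set ℂ} {z : ℂ}

theorem sideDist_chord_right_pos (hK : IsConvexDomain K) (hz : z ∈ interior K)
    {θ ψ : ℝ} (hψ : ψ ∈ Ioo θ (θ + Real.pi)) :
    0 < sideDist θ (boundaryCurve K z ψ - boundaryCurve K z θ) := by
  rw [sideDist_boundaryCurve_sub, sub_self, Real.sin_zero, mul_zero, sub_zero]
  exact mul_pos (radialFunction_pos hK hz ψ)
    (Real.sin_pos_of_pos_of_lt_pi (by linarith [hψ.1]) (by linarith [hψ.2]))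

theorem sideDist_chord_left_pos (hK : IsConvexDomain K) (hz : z ∈ interior K)
    {θ ψ : ℝ} (hψ : ψ ∈ Ioo (θ - Real.pi) θ) :
    0 < sideDist θ (boundaryCurve K z θ - boundaryCurve K z ψ) := by
  rw [← neg_sub, sideDist_neg, sideDist_boundaryCurve_sub, sub_self, Real.sin_zero, mul_zero,
    sub_zero, ← mul_neg, ← Real.sin_neg]
  exact mul_pos (radialFunction_pos hK hz ψ)
    (Real.sin_pos_of_pos_of_lt_pi (by linarith [hψ.2]) (by linarith [hψ.1]))

/-! ### Monotonicity of the tangent angles -/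

theorem tangentAngleRight_le_chordAngle (hK : IsConvexDomain K) (hz : z ∈ interior K) {θ ψ : ℝ}
    (hψ : ψ ∈ Ioo θ (θ + Real.pi)) :
    tangentAngleRight K z θ ≤ chordAngle θ (boundaryCurve K z ψ - boundaryCurve K z θ) := by
  refine add_le_add_right (csInf_le ⟨0, ?_⟩ (mem_image_of_mem _ hψ)) θ
  rintro _ ⟨ψ', hψ', rfl⟩
  exact Complex.arg_nonneg_iff.2 (sideDist_chord_right_pos hK hz hψ').le

theorem chordAngle_le_tangentAngleLeft {θ ψ : ℝ} (hψ : ψ ∈ Ioo (θ - Real.pi) θ) :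
    chordAngle θ (boundaryCurve K z θ - boundaryCurve K z ψ) ≤ tangentAngleLeft K z θ := by
  unfold chordAngle tangentAngleLeft
  gcongr
  refine le_csSup ⟨Real.pi, ?_⟩ ⟨ψ, hψ, rfl⟩
  rintro _ ⟨ψ', hψ', rfl⟩
  exact Complex.arg_le_pi _

theorem le_tangentAngleRight {θ c : ℝ} (h : ∀ ψ ∈ Ioo θ (θ + Real.pi),
    c ≤ chordAngle θ (boundaryCurve K z ψ - boundaryCurve K z θ)) :
    c ≤ tangentAngleRight K z θ := by
  rw [tangentAngleRight, ← sub_le_iff_le_add']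
  refine le_csInf ((nonempty_Ioo.2 (by linarith [Real.pi_pos])).image _) ?_
  rintro _ ⟨ψ, hψ, rfl⟩
  rw [sub_le_iff_le_add']
  exact h ψ hψ

theorem tangentAngleLeft_le {θ c : ℝ} (h : ∀ ψ ∈ Ioo (θ - Real.pi) θ,
    chordAngle θ (boundaryCurve K z θ - boundaryCurve K z ψ) ≤ c) :
    tangentAngleLeft K z θ ≤ c := by
  rw [tangentAngleLeft, ← le_sub_iff_add_le']
  refine csSup_le ((nonempty_Ioo.2 (by linarith [Real.pi_pos])).image _) ?_
  rintro _ ⟨ψ, hψ, rfl⟩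
  rw [le_sub_iff_add_le']
  exact h ψ hψ

theorem IsSupportDirection.tangentAngleLeft_le_le_tangentAngleRight (hK : IsConvexDomain K)
    (hz : z ∈ interior K) {θ τ : ℝ} (hτ : τ ∈ Ioo θ (θ + Real.pi))
    (h : IsSupportDirection K τ (boundaryCurve K z θ)) :
    tangentAngleLeft K z θ ≤ τ ∧ τ ≤ tangentAngleRight K z θ := by
  constructor
  · refine tangentAngleLeft_le fun ψ hψ => ?_
    refine chordAngle_le (sideDist_chord_left_pos hK hz hψ) hτ ?_
    rw [← neg_sub, sideDist_neg]
    linarith [h.2 _ (boundaryCurve_mem hK hz ψ)]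
  · refine le_tangentAngleRight fun ψ hψ => ?_
    exact le_chordAngle (sideDist_chord_right_pos hK hz hψ) hτ (h.2 _ (boundaryCurve_mem hK hz ψ))

theorem IsSupportDirection.add_int_mul_two_pi {τ : ℝ} {w : ℂ} (h : IsSupportDirection K τ w)
    (m : ℤ) : IsSupportDirection K (τ + m * (2 * Real.pi)) w := by
  refine ⟨h.1, fun x hx => ?_⟩
  have := h.2 x hx
  rwa [sideDist_eq, Real.cos_add_int_mul_two_pi, Real.sin_add_int_mul_two_pi, ← sideDist_eq]

/-- A line supporting `K` at `γ θ` has, on a suitable branch, its angle in `(θ, θ + π)`. -/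
theorem IsSupportDirection.exists_mem_Ioo (hK : IsConvexDomain K)
    (hz : z ∈ interior K) {θ τ : ℝ} (h : IsSupportDirection K τ (boundaryCurve K z θ)) :
    ∃ m : ℤ, τ + m * (2 * Real.pi) ∈ Ioo θ (θ + Real.pi) := by
  have hpos := h.sideDist_pos hz
  have hs : 0 < Real.sin (τ - θ) := by
    rw [boundaryCurve, sub_add_cancel_left, sideDist_neg, sideDist_polar, ← mul_neg,
      ← Real.sin_neg, neg_sub] at hpos
    exact (mul_pos_iff_of_pos_left (radialFunction_pos hK hz θ)).1 hpos
  have hm := toIocMod_mem_Ioc Real.two_pi_pos θ τ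
  refine ⟨-toIocDiv Real.two_pi_pos θ τ, ?_⟩
  have e : τ + ((-toIocDiv Real.two_pi_pos θ τ : ℤ) : ℝ) * (2 * Real.pi) =
      toIocMod Real.two_pi_pos θ τ := by
    rw [toIocMod, zsmul_eq_mul]
    push_cast
    ring
  rw [← Real.sin_add_int_mul_two_pi _ (-toIocDiv Real.two_pi_pos θ τ), sub_add_eq_add_sub, e] at hs
  rw [e]
  refine ⟨hm.1, ?_⟩
  by_contra! hge
  have := Real.sin_nonneg_of_nonneg_of_le_pi (x := toIocMod Real.two_pi_pos θ τ - θ - Real.pi)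
    (by linarith) (by linarith [hm.2])
  rw [Real.sin_sub_pi] at this
  linarith

theorem tangentAngleLeft_le_tangentAngleRight (hK : IsConvexDomain K) (hz : z ∈ interior K)
    (θ : ℝ) : tangentAngleLeft K z θ ≤ tangentAngleRight K z θ := by
  obtain ⟨τ, hτ⟩ :=
    exists_isSupportDirection_of_mem_frontier hK (boundaryCurve_mem_frontier hK hz θ)
  obtain ⟨m, hm⟩ := hτ.exists_mem_Ioo hK hz
  obtain ⟨h1, h2⟩ :=
    (hτ.add_int_mul_two_pi m).tangentAngleLeft_le_le_tangentAngleRight hK hz hm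
  exact h1.trans h2

/-- Both angles are compared with the angle of the chord from `γ θ` to `γ ψ`. -/
theorem tangentAngleRight_le_tangentAngleLeft (hK : IsConvexDomain K) (hz : z ∈ interior K)
    {θ ψ : ℝ} (h : θ < ψ) : tangentAngleRight K z θ ≤ tangentAngleLeft K z ψ := by
  rcases lt_or_ge ψ (θ + Real.pi) with h' | h'
  · have hψ : ψ ∈ Ioo θ (θ + Real.pi) := ⟨h, h'⟩
    have hθ : θ ∈ Ioo (ψ - Real.pi) ψ := ⟨by linarith, h⟩
    refine (tangentAngleRight_le_chordAngle hK hz hψ).trans ?_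
    rw [chordAngle_eq_chordAngle h.le h' (sideDist_chord_right_pos hK hz hψ)
      (sideDist_chord_left_pos hK hz hθ)]
    exact chordAngle_le_tangentAngleLeft hθ
  · have hp := Real.pi_pos
    have h1 : θ + Real.pi / 2 ∈ Ioo θ (θ + Real.pi) := ⟨by linarith, by linarith⟩
    have h2 : ψ - Real.pi / 2 ∈ Ioo (ψ - Real.pi) ψ := ⟨by linarith, by linarith⟩
    have h3 := tangentAngleRight_le_chordAngle hK hz h1
    have h4 := chordAngle_le_tangentAngleLeft (K := K) (z := z) h2
    have h5 := (chordAngle_mem_Ioo (sideDist_chord_right_pos hK hz h1)).2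
    have h6 := (chordAngle_mem_Ioo (sideDist_chord_left_pos hK hz h2)).1
    linarith

theorem monotone_tangentAngleRight (hK : IsConvexDomain K) (hz : z ∈ interior K) :
    Monotone (tangentAngleRight K z) := by
  intro θ ψ h
  rcases h.eq_or_lt with rfl | h
  · exact le_rfl
  · exact (tangentAngleRight_le_tangentAngleLeft hK hz h).trans
      (tangentAngleLeft_le_tangentAngleRight hK hz ψ)

theorem monotone_tangentAngleLeft (hK : IsConvexDomain K) (hz : z ∈ interior K) :
    Monotone (tangentAngleLeft K z) := by
  intro θ ψ h
  rcases h.eq_or_lt with rfl | h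
  · exact le_rfl
  · exact (tangentAngleLeft_le_tangentAngleRight hK hz θ).trans
      (tangentAngleRight_le_tangentAngleLeft hK hz h)

theorem exp_neg_add_int_mul_two_pi (θ : ℝ) (m : ℤ) :
    Complex.exp (-((θ + m * (2 * Real.pi) : ℝ) : ℂ) * Complex.I) =
      Complex.exp (-(θ : ℂ) * Complex.I) := by
  rw [← Complex.exp_periodic.int_mul (-m) (-(θ : ℂ) * Complex.I)]
  push_cast
  ring_nf

theorem tangentAngleRight_add_int_mul_two_pi (K : Set ℂ) (z : ℂ) (θ : ℝ) (m : ℤ) :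
    tangentAngleRight K z (θ + m * (2 * Real.pi)) =
      tangentAngleRight K z θ + m * (2 * Real.pi) := by
  have hI : Ioo (θ + m * (2 * Real.pi)) (θ + m * (2 * Real.pi) + Real.pi) =
      (fun ψ => ψ + m * (2 * Real.pi)) '' Ioo θ (θ + Real.pi) := by
    rw [image_add_const_Ioo, add_right_comm]
  rw [tangentAngleRight, tangentAngleRight, hI, image_image]
  simp only [boundaryCurve_add_int_mul_two_pi, exp_neg_add_int_mul_two_pi]
  ring

theorem tangentAngleLeft_add_int_mul_two_pi (K : Set ℂ) (z : ℂ) (θ : ℝ) (m : ℤ) :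
    tangentAngleLeft K z (θ + m * (2 * Real.pi)) =
      tangentAngleLeft K z θ + m * (2 * Real.pi) := by
  have hI : Ioo (θ + m * (2 * Real.pi) - Real.pi) (θ + m * (2 * Real.pi)) =
      (fun ψ => ψ + m * (2 * Real.pi)) '' Ioo (θ - Real.pi) θ := by
    rw [image_add_const_Ioo, sub_add_eq_add_sub]
  rw [tangentAngleLeft, tangentAngleLeft, hI, image_image]
  simp only [boundaryCurve_add_int_mul_two_pi, exp_neg_add_int_mul_two_pi]
  ring

end

/-! ### Arc length -/

section

variable {K : Set ℂ} {z : ℂ}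

theorem locallyBoundedVariationOn_boundaryCurve (hK : IsConvexDomain K) (hz : z ∈ interior K) :
    LocallyBoundedVariationOn (boundaryCurve K z) univ := by
  obtain ⟨C, hC⟩ := exists_lipschitzWith_boundaryCurve hK hz
  exact hC.locallyBoundedVariationOn univ

theorem variationOnFromTo_sub (hK : IsConvexDomain K) (hz : z ∈ interior K) {φ ψ : ℝ}
    (h : φ ≤ ψ) : variationOnFromTo (boundaryCurve K z) univ 0 ψ -
      variationOnFromTo (boundaryCurve K z) univ 0 φ = arcLength K z φ ψ := by
  rw [variationOnFromTo.sub_right (locallyBoundedVariationOn_boundaryCurve hK hz) (mem_univ _)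
    (mem_univ _) (mem_univ _), variationOnFromTo.eq_of_le _ _ h, univ_inter, arcLength]

theorem norm_boundaryCurve_sub_le_arcLength (hK : IsConvexDomain K) (hz : z ∈ interior K)
    {φ ψ : ℝ} (h : φ ≤ ψ) :
    ‖boundaryCurve K z ψ - boundaryCurve K z φ‖ ≤ arcLength K z φ ψ := by
  have hbv := locallyBoundedVariationOn_boundaryCurve hK hz φ ψ (mem_univ _) (mem_univ _)
  rw [univ_inter] at hbv
  rw [← dist_eq_norm]
  exact hbv.dist_le (right_mem_Icc.2 h) (left_mem_Icc.2 h)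

theorem arcLength_add (hK : IsConvexDomain K) (hz : z ∈ interior K) {φ ψ χ : ℝ}
    (h : φ ≤ ψ) (h' : ψ ≤ χ) :
    arcLength K z φ ψ + arcLength K z ψ χ = arcLength K z φ χ := by
  rw [← variationOnFromTo_sub hK hz h, ← variationOnFromTo_sub hK hz h',
    ← variationOnFromTo_sub hK hz (h.trans h')]
  ring

theorem arcLength_add_int_mul_two_pi (K : Set ℂ) (z : ℂ) (φ ψ : ℝ) (m : ℤ) :
    arcLength K z (φ + m * (2 * Real.pi)) (ψ + m * (2 * Real.pi)) = arcLength K z φ ψ := by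
  have hmono : MonotoneOn (fun x : ℝ => x + m * (2 * Real.pi)) (Icc φ ψ) :=
    fun x _ y _ h => add_le_add_left h _
  have := eVariationOn.comp_eq_of_monotoneOn (boundaryCurve K z) _ hmono
  rw [image_add_const_Icc] at this
  rw [arcLength, arcLength, ← this]
  congr 2
  ext x
  exact boundaryCurve_add_int_mul_two_pi K z x m

theorem strictMono_variationOnFromTo (hK : IsConvexDomain K) (hz : z ∈ interior K) :
    StrictMono (variationOnFromTo (boundaryCurve K z) univ 0) := by
  intro φ ψ h
  -- on an arc of polar angle less than `π` the end points are distinct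
  set χ := min ψ (φ + Real.pi / 2) with hχ
  have hp := Real.pi_pos
  have h1 : φ < χ := lt_min h (by linarith)
  have h2 : χ < φ + Real.pi := (min_le_right _ _).trans_lt (by linarith)
  have h3 := norm_pos_iff.2 (ne_zero_of_sideDist_pos
    (sideDist_chord_right_pos hK hz (θ := φ) (ψ := χ) ⟨h1, h2⟩))
  have h4 := norm_boundaryCurve_sub_le_arcLength hK hz h1.le
  rw [← variationOnFromTo_sub hK hz h1.le] at h4
  have h5 := variationOnFromTo.monotoneOn (locallyBoundedVariationOn_boundaryCurve hK hz)
    (mem_univ (0 : ℝ)) (mem_univ χ) (mem_univ ψ) (min_le_left _ _)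
  linarith

theorem continuous_variationOnFromTo (hK : IsConvexDomain K) (hz : z ∈ interior K) :
    Continuous (variationOnFromTo (boundaryCurve K z) univ 0) := by
  obtain ⟨C, hC⟩ := exists_lipschitzWith_boundaryCurve hK hz
  refine (LipschitzWith.of_le_add_mul C fun x y => ?_).continuous
  rcases le_total x y with h | h
  · have := (strictMono_variationOnFromTo hK hz).monotone h
    have : 0 ≤ C * dist x y := by positivity
    linarith
  · have h1 := variationOnFromTo_sub hK hz h
    have h2 : arcLength K z y x ≤ C * dist x y := by
      have h3 := hC.lipschitzOnWith.comp_eVariationOn_le (mapsTo_univ id (Icc y x))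
      rw [Function.comp_id, eVariationOn_id_Icc] at h3
      refine ENNReal.toReal_le_of_le_ofReal (by positivity) (h3.trans_eq ?_)
      rw [Real.dist_eq, abs_of_nonneg (by linarith), ENNReal.ofReal_mul (by positivity),
        ENNReal.ofReal_coe_nnreal]
    linarith

theorem angleOfArcLength_variationOnFromTo (hK : IsConvexDomain K) (hz : z ∈ interior K)
    (φ : ℝ) : angleOfArcLength K z (variationOnFromTo (boundaryCurve K z) univ 0 φ) = φ :=
  Function.leftInverse_invFun (strictMono_variationOnFromTo hK hz).injective φ

theorem variationOnFromTo_two_pi (hK : IsConvexDomain K) (hz : z ∈ interior K) :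
    variationOnFromTo (boundaryCurve K z) univ 0 (2 * Real.pi) = perimeter K z := by
  rw [perimeter, ← variationOnFromTo_sub hK hz Real.two_pi_pos.le, variationOnFromTo.self,
    sub_zero]

theorem variationOnFromTo_mem_Icc (hK : IsConvexDomain K) (hz : z ∈ interior K) {φ : ℝ}
    (h : φ ∈ Icc 0 (2 * Real.pi)) :
    variationOnFromTo (boundaryCurve K z) univ 0 φ ∈ Icc 0 (perimeter K z) := by
  have hm := (strictMono_variationOnFromTo hK hz).monotone
  rw [← variationOnFromTo_two_pi hK hz]
  exact ⟨variationOnFromTo.nonneg_of_le _ _ h.1, hm h.2⟩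

theorem exists_variationOnFromTo_eq (hK : IsConvexDomain K) (hz : z ∈ interior K) {s : ℝ}
    (hs : s ∈ Icc 0 (perimeter K z)) :
    ∃ φ ∈ Icc 0 (2 * Real.pi), variationOnFromTo (boundaryCurve K z) univ 0 φ = s := by
  apply intermediate_value_Icc Real.two_pi_pos.le
    (continuous_variationOnFromTo hK hz).continuousOn
  rwa [variationOnFromTo.self, variationOnFromTo_two_pi hK hz]

theorem alphaMinus_le_alphaPlus (hK : IsConvexDomain K) (hz : z ∈ interior K) (s : ℝ) :
    alphaMinus K z s ≤ alphaPlus K z s :=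
  tangentAngleLeft_le_tangentAngleRight hK hz _

theorem alphaPlus_le_alphaMinus (hK : IsConvexDomain K) (hz : z ∈ interior K) {x y : ℝ}
    (hx : x ∈ Icc 0 (perimeter K z)) (hy : y ∈ Icc 0 (perimeter K z)) (h : x < y) :
    alphaPlus K z x ≤ alphaMinus K z y := by
  obtain ⟨φ, -, rfl⟩ := exists_variationOnFromTo_eq hK hz hx
  obtain ⟨ψ, -, rfl⟩ := exists_variationOnFromTo_eq hK hz hy
  rw [alphaPlus, alphaMinus, angleOfArcLength_variationOnFromTo hK hz,
    angleOfArcLength_variationOnFromTo hK hz]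
  exact tangentAngleRight_le_tangentAngleLeft hK hz
    ((strictMono_variationOnFromTo hK hz).lt_iff_lt.1 h)

theorem monotoneOn_tangentAngle (hK : IsConvexDomain K) (hz : z ∈ interior K) :
    MonotoneOn (tangentAngle K z) (Icc 0 (perimeter K z)) := by
  intro x hx y hy h
  rcases h.eq_or_lt with rfl | h
  · exact le_rfl
  · have h1 := alphaPlus_le_alphaMinus hK hz hx hy h
    have h2 := alphaMinus_le_alphaPlus hK hz x
    have h3 := alphaMinus_le_alphaPlus hK hz y
    rw [tangentAngle, tangentAngle]
    linarith

/-! ### Equivalence of the curvature conditions -/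

/-- A monotone function grows at least as fast as the integral of its derivative. -/
theorem mul_sub_le_sub_of_ae_le_deriv {f : ℝ → ℝ} {a b c : ℝ} (hab : a ≤ b)
    (hf : MonotoneOn f (Icc a b)) (h : ∀ᵐ s ∂(volume.restrict (Icc a b)), c ≤ deriv f s) :
    c * (b - a) ≤ f b - f a := by
  rw [← uIcc_of_le hab] at hf
  have h1 := hf.intervalIntegral_deriv_mem_uIcc
  rw [uIcc_of_le (sub_nonneg.2 (hf left_mem_uIcc right_mem_uIcc hab))] at h1
  have h2 := intervalIntegral.integral_mono_ae_restrict hab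
    (intervalIntegrable_const (μ := volume) (c := c)) hf.intervalIntegrable_deriv h
  rw [intervalIntegral.integral_const, smul_eq_mul] at h2
  linarith [h1.2]

/-- The bound on the curvature is integrated between points approaching `x` and `y` from inside
the arc, where `α` lies between `α₊(x)` and `α₋(y)`. -/
theorem CurvatureGeAE.mul_sub_le_alphaMinus_sub_alphaPlus (hK : IsConvexDomain K)
    (hz : z ∈ interior K) {κ : ℝ} (hκ : 0 < κ) (h : CurvatureGeAE K z κ) {x y : ℝ}
    (hx : x ∈ Icc 0 (perimeter K z)) (hy : y ∈ Icc 0 (perimeter K z)) (hxy : x < y) :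
    κ * (y - x) ≤ alphaMinus K z y - alphaPlus K z x := by
  refine le_of_forall_pos_le_add fun e he => ?_
  set d := min ((y - x) / 2) (e / (2 * κ)) with hd
  have hd0 : 0 < d := lt_min (by linarith) (by positivity)
  have hd1 : d ≤ (y - x) / 2 := min_le_left _ _
  have hd2 : κ * (2 * d) ≤ e := by
    have : d ≤ e / (2 * κ) := min_le_right _ _
    rw [le_div_iff₀ (by positivity)] at this
    linarith
  have hx' : x + d ∈ Icc 0 (perimeter K z) := ⟨by linarith [hx.1], by linarith [hy.2]⟩
  have hy' : y - d ∈ Icc 0 (perimeter K z) := ⟨by linarith [hx.1], by linarith [hy.2]⟩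
  have hsub : Icc (x + d) (y - d) ⊆ Icc 0 (perimeter K z) := Icc_subset_Icc hx'.1 hy'.2
  have h1 := mul_sub_le_sub_of_ae_le_deriv (by linarith)
    ((monotoneOn_tangentAngle hK hz).mono hsub)
    ((ae_restrict_of_ae_restrict_of_subset hsub h).mono fun s hs => hs.2)
  have h2 := alphaPlus_le_alphaMinus hK hz hx hx' (by linarith)
  have h3 := alphaPlus_le_alphaMinus hK hz hy' hy (by linarith)
  have h4 := alphaMinus_le_alphaPlus hK hz (x + d)
  have h5 := alphaMinus_le_alphaPlus hK hz (y - d)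
  rw [tangentAngle, tangentAngle] at h1
  linarith

theorem CurvatureGeAE.angleIncrementGe (hK : IsConvexDomain K) (hz : z ∈ interior K) {κ : ℝ}
    (hκ : 0 < κ) (h : CurvatureGeAE K z κ) : AngleIncrementGe K z κ := by
  intro x hx y hy hxy
  rcases hxy.eq_or_lt with rfl | hxy
  · simp
  · have h1 := h.mul_sub_le_alphaMinus_sub_alphaPlus hK hz hκ hx hy hxy
    have h2 := alphaMinus_le_alphaPlus hK hz x
    have h3 := alphaMinus_le_alphaPlus hK hz y
    constructor <;> linarith

theorem AngleIncrementGe.curvatureGeAE (hK : IsConvexDomain K) (hz : z ∈ interior K) {κ : ℝ}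
    (h : AngleIncrementGe K z κ) : CurvatureGeAE K z κ := by
  have ha : 0 ≤ perimeter K z := ENNReal.toReal_nonneg
  have hm := monotoneOn_tangentAngle hK hz
  have hbv : BoundedVariationOn (tangentAngle K z) (uIcc 0 (perimeter K z)) := by
    rw [uIcc_of_le ha]
    have := hm.locallyBoundedVariationOn 0 _ (left_mem_Icc.2 ha) (right_mem_Icc.2 ha)
    rwa [inter_self] at this
  have hd := hbv.ae_differentiableAt_of_mem_uIcc
  rw [uIcc_of_le ha] at hd
  rw [CurvatureGeAE, ← restrict_Ioo_eq_restrict_Icc, ae_restrict_iff' measurableSet_Ioo]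
  filter_upwards [hd] with s hs hs'
  have hds := hs (Ioo_subset_Icc_self hs')
  refine ⟨hds, ?_⟩
  have hmono : MonotoneOn (fun t => tangentAngle K z t - κ * t) (Ioo 0 (perimeter K z)) := by
    intro x hx y hy hxy
    obtain ⟨h1, h2⟩ := h x (Ioo_subset_Icc_self hx) y (Ioo_subset_Icc_self hy) hxy
    simp only [tangentAngle]
    linarith
  have h1 := hmono.derivWithin_nonneg (x := s)
  have h2 : HasDerivAt (fun t => tangentAngle K z t - κ * t) (curvature K z s - κ * 1) s :=
    hds.hasDerivAt.sub ((hasDerivAt_id s).const_mul κ)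
  rw [derivWithin_of_isOpen isOpen_Ioo hs', h2.deriv] at h1
  linarith

theorem curvatureGeAE_iff_curvatureRadiusLeAE {κ : ℝ} (hκ : 0 < κ) :
    CurvatureGeAE K z κ ↔ CurvatureRadiusLeAE K z κ := by
  refine Filter.eventually_congr (Filter.Eventually.of_forall fun s => ?_)
  rw [curvatureRadius, ENNReal.inv_le_inv, ENNReal.ofReal_le_ofReal_iff']
  exact and_congr_right fun _ => ⟨Or.inl, fun h => h.resolve_right hκ.not_ge⟩

theorem AngleIncrementGe.mul_arcLength_le (hK : IsConvexDomain K) (hz : z ∈ interior K) {κ : ℝ}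
    (h : AngleIncrementGe K z κ) {φ ψ : ℝ} (h0 : 0 ≤ φ) (hφψ : φ ≤ ψ) (hψ : ψ ≤ 2 * Real.pi) :
    κ * arcLength K z φ ψ ≤ tangentAngleRight K z ψ - tangentAngleRight K z φ ∧
    κ * arcLength K z φ ψ ≤ tangentAngleLeft K z ψ - tangentAngleLeft K z φ := by
  have := h _ (variationOnFromTo_mem_Icc hK hz ⟨h0, hφψ.trans hψ⟩) _
    (variationOnFromTo_mem_Icc hK hz ⟨h0.trans hφψ, hψ⟩)
    ((strictMono_variationOnFromTo hK hz).monotone hφψ)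
  rwa [alphaPlus, alphaPlus, alphaMinus, alphaMinus, angleOfArcLength_variationOnFromTo hK hz,
    angleOfArcLength_variationOnFromTo hK hz, variationOnFromTo_sub hK hz hφψ] at this

theorem AngleIncrementGe.subdifferentialCondition (hK : IsConvexDomain K) (hz : z ∈ interior K)
    {κ : ℝ} (h : AngleIncrementGe K z κ) : SubdifferentialCondition K z κ := by
  intro φ ψ hφψ hψ
  suffices hs : κ * arcLength K z φ ψ ≤ tangentAngleRight K z ψ - tangentAngleRight K z φ ∧
      κ * arcLength K z φ ψ ≤ tangentAngleLeft K z ψ - tangentAngleLeft K z φ from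
    ⟨hs.1.trans (le_abs_self _), hs.2.trans (le_abs_self _)⟩
  -- shift the starting point of the arc into `[0, 2π)`
  obtain ⟨m, hm⟩ : ∃ m : ℤ, φ + m * (2 * Real.pi) ∈ Ico 0 (2 * Real.pi) := by
    refine ⟨-toIcoDiv Real.two_pi_pos 0 φ, ?_⟩
    have := sub_toIcoDiv_zsmul_mem_Ico Real.two_pi_pos 0 φ
    rw [zsmul_eq_mul, zero_add] at this
    push_cast
    rwa [neg_mul, ← sub_eq_add_neg]
  have key : ∀ φ ψ : ℝ, φ ∈ Ico 0 (2 * Real.pi) → φ ≤ ψ → ψ ≤ φ + 2 * Real.pi →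
      κ * arcLength K z φ ψ ≤ tangentAngleRight K z ψ - tangentAngleRight K z φ ∧
      κ * arcLength K z φ ψ ≤ tangentAngleLeft K z ψ - tangentAngleLeft K z φ := by
    intro φ ψ hφ hφψ hψ
    rcases le_total ψ (2 * Real.pi) with hle | hge
    · exact h.mul_arcLength_le hK hz hφ.1 hφψ hle
    · -- the arc passes through `γ 0`: split it there
      obtain ⟨h1, h2⟩ := h.mul_arcLength_le hK hz hφ.1 hφ.2.le le_rfl
      obtain ⟨h3, h4⟩ := h.mul_arcLength_le hK hz (φ := 0) (ψ := ψ - 2 * Real.pi) le_rfl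
        (by linarith) (by linarith [hφ.2])
      have e1 := arcLength_add hK hz hφ.2.le hge
      have e2 := arcLength_add_int_mul_two_pi K z 0 (ψ - 2 * Real.pi) 1
      have e3 := tangentAngleRight_add_int_mul_two_pi K z (ψ - 2 * Real.pi) 1
      have e4 := tangentAngleLeft_add_int_mul_two_pi K z (ψ - 2 * Real.pi) 1
      have e5 := tangentAngleRight_add_int_mul_two_pi K z 0 1
      have e6 := tangentAngleLeft_add_int_mul_two_pi K z 0 1
      simp only [Int.cast_one, one_mul, zero_add, sub_add_cancel] at e2 e3 e4 e5 e6
      rw [← e1, e2, mul_add]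
      constructor <;> linarith
  have := key _ (ψ + m * (2 * Real.pi)) hm (by linarith) (by linarith)
  rw [arcLength_add_int_mul_two_pi, tangentAngleRight_add_int_mul_two_pi,
    tangentAngleRight_add_int_mul_two_pi, tangentAngleLeft_add_int_mul_two_pi,
    tangentAngleLeft_add_int_mul_two_pi, add_sub_add_right_eq_sub,
    add_sub_add_right_eq_sub] at this
  exact this

theorem SubdifferentialCondition.angleIncrementGe (hK : IsConvexDomain K) (hz : z ∈ interior K)
    {κ : ℝ} (h : SubdifferentialCondition K z κ) : AngleIncrementGe K z κ := by
  intro x hx y hy hxy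
  obtain ⟨φ, hφ, rfl⟩ := exists_variationOnFromTo_eq hK hz hx
  obtain ⟨ψ, hψ, rfl⟩ := exists_variationOnFromTo_eq hK hz hy
  have hφψ := (strictMono_variationOnFromTo hK hz).le_iff_le.1 hxy
  have := h φ ψ hφψ (by linarith [hφ.1, hψ.2])
  rw [alphaPlus, alphaPlus, alphaMinus, alphaMinus, angleOfArcLength_variationOnFromTo hK hz,
    angleOfArcLength_variationOnFromTo hK hz]
  rwa [abs_of_nonneg (sub_nonneg.2 (monotone_tangentAngleRight hK hz hφψ)),
    abs_of_nonneg (sub_nonneg.2 (monotone_tangentAngleLeft hK hz hφψ)),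
    ← variationOnFromTo_sub hK hz hφψ] at this

theorem tfae_curvature_conditions (hK : IsConvexDomain K) (hz : z ∈ interior K) {κ : ℝ}
    (hκ : 0 < κ) : List.TFAE [CurvatureGeAE K z κ, CurvatureRadiusLeAE K z κ,
      AngleIncrementGe K z κ, SubdifferentialCondition K z κ] := by
  tfae_have 1 ↔ 2 := curvatureGeAE_iff_curvatureRadiusLeAE hκ
  tfae_have 1 → 3 := fun h => h.angleIncrementGe hK hz hκ
  tfae_have 3 → 1 := fun h => h.curvatureGeAE hK hz
  tfae_have 3 → 4 := fun h => h.subdifferentialCondition hK hz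
  tfae_have 4 → 3 := fun h => h.angleIncrementGe hK hz
  tfae_finish

end

/-! ### Lipschitz dependence of support points on the direction -/

section

variable {K : Set ℂ} {z : ℂ}

theorem IsSupportDirection.exists_boundaryCurve_eq (hK : IsConvexDomain K)
    (hz : z ∈ interior K) {τ : ℝ} {w : ℂ} (h : IsSupportDirection K τ w) :
    ∃ φ, boundaryCurve K z φ = w ∧ τ ∈ Ioo φ (φ + Real.pi) := by
  have hwz : w - z ≠ 0 := by
    intro h0
    have := h.sideDist_pos hz
    rw [← neg_sub, h0, neg_zero, sideDist_zero] at this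
    exact lt_irrefl _ this
  have hγ : boundaryCurve K z (w - z).arg = w :=
    eq_boundaryCurve_of_mem_frontier hK hz h.mem_frontier (norm_pos_iff.2 hwz)
      (Complex.norm_mul_exp_arg_mul_I _).symm
  have h' := h
  rw [← hγ] at h'
  obtain ⟨m, hm⟩ := h'.exists_mem_Ioo hK hz
  refine ⟨(w - z).arg + (-m : ℤ) * (2 * Real.pi), ?_, ?_⟩
  · rw [boundaryCurve_add_int_mul_two_pi, hγ]
  · push_cast
    constructor <;> linarith [hm.1, hm.2]

/-- The length of a chord is bounded by the increment of the tangent angle over the open arc. -/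
theorem SubdifferentialCondition.mul_norm_sub_le (hK : IsConvexDomain K) (hz : z ∈ interior K)
    {κ : ℝ} (hκ : 0 < κ) (h : SubdifferentialCondition K z κ) {φ ψ : ℝ} (hφψ : φ < ψ)
    (hψ : ψ ≤ φ + 2 * Real.pi) :
    κ * ‖boundaryCurve K z ψ - boundaryCurve K z φ‖ ≤
      tangentAngleLeft K z ψ - tangentAngleRight K z φ := by
  obtain ⟨C, hC⟩ := exists_lipschitzWith_boundaryCurve hK hz
  have hcont : Continuous fun u => κ * ‖boundaryCurve K z ψ - boundaryCurve K z u‖ :=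
    continuous_const.mul (continuous_const.sub hC.continuous).norm
  -- start the chord slightly after `φ`, where the left tangent angle is at least `α₊(φ)`
  refine le_of_tendsto (hcont.continuousWithinAt (s := Ioi φ) (x := φ)) ?_
  filter_upwards [Ioo_mem_nhdsGT hφψ] with u hu
  have h1 := (h u ψ hu.2.le (by linarith [hu.1])).2
  rw [abs_of_nonneg (sub_nonneg.2 (monotone_tangentAngleLeft hK hz hu.2.le))] at h1
  have h2 := mul_le_mul_of_nonneg_left (norm_boundaryCurve_sub_le_arcLength hK hz hu.2.le) hκ.le
  have h3 := tangentAngleRight_le_tangentAngleLeft hK hz hu.1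
  linarith

/-- The support point is a Lipschitz function of the supporting direction, with constant `1 / κ`. -/
theorem SubdifferentialCondition.mul_norm_sub_le_of_isSupportDirection (hK : IsConvexDomain K)
    (hz : z ∈ interior K) {κ : ℝ} (hκ : 0 < κ) (h : SubdifferentialCondition K z κ)
    {τ τ' : ℝ} {p q : ℂ} (hp : IsSupportDirection K τ p) (hq : IsSupportDirection K τ' q)
    (h1 : τ < τ') (h2 : τ' < τ + Real.pi) : κ * ‖q - p‖ ≤ τ' - τ := by
  obtain ⟨φ, rfl, hφ⟩ := hp.exists_boundaryCurve_eq hK hz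
  obtain ⟨ψ, rfl, hψ⟩ := hq.exists_boundaryCurve_eq hK hz
  have hp' := hp.tangentAngleLeft_le_le_tangentAngleRight hK hz hφ
  have hq' := hq.tangentAngleLeft_le_le_tangentAngleRight hK hz hψ
  rcases lt_trichotomy φ ψ with hlt | rfl | hgt
  · have := h.mul_norm_sub_le hK hz hκ hlt (by linarith [hφ.2, hψ.1])
    linarith [hp'.2, hq'.1]
  · rw [sub_self, norm_zero]
    linarith
  · have := tangentAngleRight_le_tangentAngleLeft hK hz hgt
    linarith [hp'.1, hq'.2]

/-! ### The rolling disc -/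

theorem sideDist_eq_cos_sub_sin (t τ : ℝ) (v : ℂ) :
    sideDist t v = Real.cos (t - τ) * sideDist τ v -
      Real.sin (t - τ) * sideDist (τ - Real.pi / 2) v := by
  rw [sideDist_eq, sideDist_eq, sideDist_eq, Real.cos_sub_pi_div_two, Real.sin_sub_pi_div_two,
    show t = (t - τ) + τ by ring, Real.cos_add, Real.sin_add, add_sub_cancel_right]
  ring

theorem abs_sideDist_sub_sideDist_le (τ τ' : ℝ) (v : ℂ) :
    |sideDist τ v - sideDist τ' v| ≤ ‖v‖ * |τ - τ'| := by
  have h := norm_exp_mul_I_sub_le (-τ) (-τ')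
  rw [sideDist, sideDist, ← Complex.sub_im, ← mul_sub]
  refine (Complex.abs_im_le_norm _).trans ?_
  rw [norm_mul]
  gcongr
  refine (le_of_eq ?_).trans (h.trans_eq ?_)
  · push_cast
    rfl
  · rw [neg_sub_neg, abs_sub_comm]

/-- A chord between nearby support points is almost parallel to the supporting lines. -/
theorem abs_sideDist_le_of_isSupportDirection {τ τ' : ℝ} {p q : ℂ}
    (hp : IsSupportDirection K τ p) (hq : IsSupportDirection K τ' q) (h : τ ≤ τ') (t : ℝ) :
    |sideDist t (q - p)| ≤ ‖q - p‖ * (|Real.sin (t - τ)| + (τ' - τ)) := by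
  have h1 := hp.2 q hq.1
  have h2 := hq.2 p hp.1
  rw [← neg_sub q p, sideDist_neg] at h2
  have h3 := (le_abs_self _).trans (abs_sideDist_sub_sideDist_le τ τ' (q - p))
  rw [abs_sub_comm, abs_of_nonneg (sub_nonneg.2 h)] at h3
  have h4 : |sideDist τ (q - p)| ≤ ‖q - p‖ * (τ' - τ) := by
    rw [abs_of_nonneg h1]
    linarith
  rw [sideDist_eq_cos_sub_sin t τ]
  refine (abs_sub _ _).trans ?_
  rw [abs_mul, abs_mul]
  have h5 := mul_le_mul (Real.abs_cos_le_one (t - τ)) h4 (abs_nonneg _) zero_le_one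
  have h6 := mul_le_mul_of_nonneg_left (abs_sideDist_le_norm (τ - Real.pi / 2) (q - p))
    (abs_nonneg (Real.sin (t - τ)))
  linarith

theorem abs_cos_sub_cos_sub_le {a δ : ℝ} (hδ : |δ| ≤ 1) :
    |Real.cos (a - δ) - Real.cos a - δ * Real.sin a| ≤ δ ^ 2 := by
  have e : Real.cos (a - δ) - Real.cos a - δ * Real.sin a =
      Real.cos a * (Real.cos δ - 1) + Real.sin a * (Real.sin δ - δ) := by
    rw [Real.cos_sub]
    ring
  have h1 : |Real.cos δ - 1| ≤ δ ^ 2 / 2 := by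
    rw [abs_le]
    constructor
    · linarith [Real.one_sub_sq_div_two_le_cos (x := δ)]
    · linarith [Real.cos_le_one δ, sq_nonneg δ]
  have h2 : |Real.sin δ - δ| ≤ δ ^ 2 / 2 := by
    have h3 : |δ| ^ 3 ≤ δ ^ 2 := by
      rw [← sq_abs δ]
      exact pow_le_pow_of_le_one (abs_nonneg _) hδ (by norm_num)
    rw [abs_sub_comm]
    linarith [Real.abs_sub_sin_le δ, sq_nonneg δ]
  rw [e]
  refine (abs_add_le _ _).trans ?_
  rw [abs_mul, abs_mul]
  have h5 := mul_le_mul (Real.abs_cos_le_one a) h1 (abs_nonneg _) zero_le_one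
  have h6 := mul_le_mul (Real.abs_sin_le_one a) h2 (abs_nonneg _) zero_le_one
  linarith

/-- A function whose increments are bounded above by a multiple of the square of the step is
nonincreasing. -/
theorem le_of_sub_le_mul_sq {f : ℝ → ℝ} {a b C : ℝ} (hab : a ≤ b)
    (h : ∀ x y, a ≤ x → x < y → y ≤ b → y ≤ x + 1 → f y - f x ≤ C * (y - x) ^ 2) :
    f b ≤ f a := by
  rcases hab.eq_or_lt with rfl | hab
  · exact le_rfl
  rw [← sub_nonpos]
  refine ge_of_tendsto (tendsto_const_div_atTop_nhds_zero_nat (C * (b - a) ^ 2)) ?_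
  obtain ⟨N, hN⟩ := exists_nat_gt (b - a)
  filter_upwards [Filter.eventually_ge_atTop N] with n hn
  have hn' : b - a < n := hN.trans_le (by exact_mod_cast hn)
  have hn0 : (0 : ℝ) < n := by linarith
  have hstep : 0 < (b - a) / n := div_pos (by linarith) hn0
  have hsum := Finset.sum_range_sub (fun i : ℕ => f (a + i * ((b - a) / n))) n
  have hb : a + n * ((b - a) / n) = b := by
    rw [mul_div_cancel₀ _ hn0.ne']
    ring
  simp only [hb, Nat.cast_zero, zero_mul, add_zero] at hsum
  rw [← hsum]
  have hle : ∀ i ∈ Finset.range n, f (a + (i + 1 : ℕ) * ((b - a) / n)) -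
      f (a + i * ((b - a) / n)) ≤ C * ((b - a) / n) ^ 2 := by
    intro i hi
    have hi' : ((i + 1 : ℕ) : ℝ) ≤ n := by exact_mod_cast Finset.mem_range.1 hi
    have e : a + (i + 1 : ℕ) * ((b - a) / n) - (a + i * ((b - a) / n)) = (b - a) / n := by
      push_cast
      ring
    have h1 : (b - a) / n ≤ 1 := by
      rw [div_le_one hn0]
      exact hn'.le
    have h2 := mul_le_mul_of_nonneg_right hi' hstep.le
    have h3 : 0 ≤ (i : ℝ) * ((b - a) / n) := by positivity
    have := h (a + i * ((b - a) / n)) (a + (i + 1 : ℕ) * ((b - a) / n)) (by linarith)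
      (by linarith) (by linarith) (by linarith)
    rwa [e] at this
  refine (Finset.sum_le_sum hle).trans_eq ?_
  rw [Finset.sum_const, Finset.card_range, nsmul_eq_mul]
  field_simp

/-- In each direction, `K` extends beyond `w` no further than the disc of radius `1 / κ` which
touches the supporting line at `w`. For fixed `t`, the excess of the first extent over the second,
taken from a support point `X τ` in place of `w`, is nondecreasing on `[t - π, t]`, nonincreasing on
`[t, t + π]`, and vanishes at `τ = t`. -/
theorem SubdifferentialCondition.sideDist_le (hK : IsConvexDomain K) (hz : z ∈ interior K)
    {κ : ℝ} (hκ : 0 < κ) (h : SubdifferentialCondition K z κ) {β : ℝ} {w : ℂ}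
    (hw : IsSupportDirection K β w) {x : ℂ} (hx : x ∈ K) {t : ℝ}
    (ht : t ∈ Icc (β - Real.pi) (β + Real.pi)) :
    sideDist t (w - x) ≤ κ⁻¹ * (1 - Real.cos (t - β)) := by
  obtain ⟨X, hX, hXw⟩ : ∃ X : ℝ → ℂ, (∀ τ, IsSupportDirection K τ (X τ)) ∧ X β = w := by
    choose Y hY using exists_isSupportDirection hK.1 ⟨w, hw.1⟩
    refine ⟨Function.update Y β w, fun τ => ?_, Function.update_self ..⟩
    rcases eq_or_ne τ β with rfl | hne
    · rwa [Function.update_self]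
    · rw [Function.update_of_ne hne]
      exact hY τ
  set D : ℝ → ℝ := fun τ => sideDist t (X τ - X t) - κ⁻¹ * (1 - Real.cos (t - τ)) with hD
  have hDt : D t = 0 := by simp [hD, sideDist_zero]
  suffices hDβ : D β ≤ 0 by
    have h1 := (hX t).2 x hx
    have h2 : sideDist t (w - x) = sideDist t (w - X t) - sideDist t (x - X t) := by
      rw [← sideDist_sub, sub_sub_sub_cancel_right]
    simp only [hD, hXw] at hDβ
    linarith
  have hR := inv_pos.2 hκ
  have hstep : ∀ τ τ' : ℝ, τ < τ' → τ' ≤ τ + 1 →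
      |sideDist t (X τ' - X τ)| ≤ κ⁻¹ * (τ' - τ) * (|Real.sin (t - τ)| + (τ' - τ)) ∧
      |Real.cos (t - τ') - Real.cos (t - τ) - (τ' - τ) * Real.sin (t - τ)| ≤ (τ' - τ) ^ 2 := by
    intro τ τ' h1 h2
    constructor
    · refine (abs_sideDist_le_of_isSupportDirection (hX τ) (hX τ') h1.le t).trans ?_
      have h3 := h.mul_norm_sub_le_of_isSupportDirection hK hz hκ (hX τ) (hX τ') h1
        (by linarith [Real.pi_gt_three])
      gcongr
      rwa [inv_mul_eq_div, le_div_iff₀' hκ]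
    · have := abs_cos_sub_cos_sub_le (a := t - τ) (δ := τ' - τ)
        (by rw [abs_of_pos] <;> linarith)
      rwa [sub_sub_sub_cancel_right] at this
  have hinc : ∀ τ τ' : ℝ, D τ' - D τ = sideDist t (X τ' - X τ) +
      κ⁻¹ * (Real.cos (t - τ') - Real.cos (t - τ)) := by
    intro τ τ'
    simp only [hD, sideDist_sub]
    ring
  rcases le_total β t with hle | hle
  · rw [← hDt, ← neg_le_neg_iff]
    refine le_of_sub_le_mul_sq (f := fun τ => -D τ) (C := 2 * κ⁻¹) hle ?_
    intro τ τ' h1 h2 h3 h4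
    obtain ⟨h5, h6⟩ := hstep τ τ' h2 h4
    rw [abs_of_nonneg (Real.sin_nonneg_of_nonneg_of_le_pi (by linarith) (by linarith [ht.2]))]
      at h5
    have h7 := mul_le_mul_of_nonneg_left (neg_le_of_abs_le h6) hR.le
    have h8 := neg_le_of_abs_le h5
    have h9 := hinc τ τ'
    linarith
  · rw [← hDt]
    refine le_of_sub_le_mul_sq (C := 2 * κ⁻¹) hle ?_
    intro τ τ' h1 h2 h3 h4
    obtain ⟨h5, h6⟩ := hstep τ τ' h2 h4
    rw [abs_of_nonpos (Real.sin_nonpos_of_nonpos_of_neg_pi_le (by linarith)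
      (by linarith [ht.1]))] at h5
    have h7 := mul_le_mul_of_nonneg_left (le_of_abs_le h6) hR.le
    have h8 := le_of_abs_le h5
    have h9 := hinc τ τ'
    linarith

/-- Blaschke's rolling theorem: through every frontier point of `K` passes the boundary of a disc of
radius `1 / κ` which contains `K`. -/
theorem SubdifferentialCondition.exists_disc (hK : IsConvexDomain K) (hz : z ∈ interior K)
    {κ : ℝ} (hκ : 0 < κ) (h : SubdifferentialCondition K z κ) {w : ℂ} (hw : w ∈ frontier K) :
    ∃ c : ℂ, ‖w - c‖ = κ⁻¹ ∧ ∀ x ∈ K, ‖x - c‖ ≤ κ⁻¹ := by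
  obtain ⟨β, hβ⟩ := exists_isSupportDirection_of_mem_frontier hK hw
  set u : ℂ := (κ⁻¹ : ℝ) * Complex.exp ((β + Real.pi / 2 : ℝ) * Complex.I) with hu
  refine ⟨w + u, ?_, fun x hx => ?_⟩
  · rw [sub_add_cancel_left, norm_neg, hu, norm_mul, Complex.norm_exp_ofReal_mul_I, mul_one,
      Complex.norm_real, Real.norm_eq_abs, abs_of_pos (inv_pos.2 hκ)]
  -- the direction `t` of the line orthogonal to the segment from `x` to the centre of the disc
  set y : ℂ := w + u - x with hy
  set t := toIocMod Real.two_pi_pos (β - Real.pi) (y.arg - Real.pi / 2) with ht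
  have htm := toIocMod_mem_Ioc Real.two_pi_pos (β - Real.pi) (y.arg - Real.pi / 2)
  have hyt : sideDist t y = ‖y‖ := by
    conv_lhs => rw [← Complex.norm_mul_exp_arg_mul_I y]
    have e : y.arg - t = Real.pi / 2 +
        toIocDiv Real.two_pi_pos (β - Real.pi) (y.arg - Real.pi / 2) * (2 * Real.pi) := by
      rw [ht, toIocMod, zsmul_eq_mul]
      ring
    rw [sideDist_polar, e, Real.sin_add_int_mul_two_pi, Real.sin_pi_div_two, mul_one]
  have h1 := h.sideDist_le hK hz hκ hβ hx (t := t) ⟨htm.1.le, by linarith [htm.2]⟩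
  have h2 : sideDist t y = sideDist t (w - x) + κ⁻¹ * Real.cos (t - β) := by
    have e : Real.sin (β + Real.pi / 2 - t) = Real.cos (t - β) := by
      rw [← Real.cos_pi_div_two_sub]
      congr 1
      ring
    have e' : w - x = y - u := by rw [hy]; ring
    rw [← e, ← sideDist_polar, ← hu, e', sideDist_sub t y u]
    ring
  rw [← neg_sub, norm_neg, ← hy, ← hyt, h2]
  linarith

/-! ### The inverse Markov inequality -/

theorem half_le_re_div {u s : ℂ} (hne : u ≠ s) (h : ‖s‖ ≤ ‖u‖) : 1 / 2 ≤ (u / (u - s)).re := by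
  have hpos : 0 < Complex.normSq (u - s) := Complex.normSq_pos.2 (sub_ne_zero.2 hne)
  have h' : Complex.normSq s ≤ Complex.normSq u := by
    rw [Complex.normSq_eq_norm_sq, Complex.normSq_eq_norm_sq]
    gcongr
  rw [Complex.div_re, ← add_div, le_div_iff₀ hpos]
  simp only [Complex.normSq_apply, Complex.sub_re, Complex.sub_im] at *
  linarith

/-- If the zeros of `p` lie in a disc of radius `R`, then `|p'| ≥ (n / 2R) |p|` on its boundary
circle. -/
theorem natDegree_mul_norm_eval_le {p : ℂ[X]} {c w : ℂ} {R : ℝ} (hw : ‖w - c‖ = R)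
    (hp : ∀ r, p.IsRoot r → ‖r - c‖ ≤ R) :
    p.natDegree / 2 * ‖p.eval w‖ ≤ R * ‖(derivative p).eval w‖ := by
  by_cases h0 : p.eval w = 0
  · rw [h0, norm_zero, mul_zero, ← hw]
    positivity
  have hs := (IsAlgClosed.splits p).eval_derivative_div_eval_of_ne_zero h0
  have hsum : ∀ s : Multiset ℂ, (∀ r ∈ s, 1 / 2 ≤ ((w - c) / (w - r)).re) →
      (s.card : ℝ) / 2 ≤ ((w - c) * (s.map fun r => 1 / (w - r)).sum).re := by
    intro s
    induction s using Multiset.induction with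
    | empty => simp
    | cons a s ih =>
      intro hall
      have h1 := hall a (Multiset.mem_cons_self a s)
      have h2 := ih fun r hr => hall r (Multiset.mem_cons_of_mem hr)
      rw [Multiset.map_cons, Multiset.sum_cons, mul_add, Complex.add_re, mul_one_div,
        Multiset.card_cons]
      push_cast
      linarith
  have h1 := hsum p.roots fun r hr => by
    have hr' := (Polynomial.mem_roots'.1 hr).2
    have hne : w ≠ r := by
      rintro rfl
      exact h0 hr'
    have := half_le_re_div (u := w - c) (s := r - c) (by simpa using hne) (by
      rw [hw]
      exact hp r hr')
    rwa [sub_sub_sub_cancel_right] at this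
  rw [← hs, ← (IsAlgClosed.splits p).natDegree_eq_card_roots] at h1
  have h2 := h1.trans (Complex.re_le_norm _)
  rw [norm_mul, norm_div, hw, ← mul_div_assoc, le_div_iff₀ (norm_pos_iff.2 h0)] at h2
  exact h2

theorem bddAbove_norm_eval (hK : IsCompact K) (p : ℂ[X]) :
    BddAbove ((fun w : ℂ => ‖p.eval w‖) '' K) :=
  (hK.image p.continuous.norm).bddAbove

theorem SubdifferentialCondition.mul_supNormOn_le (hK : IsConvexDomain K) (hz : z ∈ interior K)
    {κ : ℝ} (hκ : 0 < κ) (h : SubdifferentialCondition K z κ) {n : ℕ} {p : ℂ[X]}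
    (hp : p ∈ polynomialsWithZerosIn n K) :
    κ / 2 * (n : ℝ) * supNormOn K p ≤ supNormOn K (derivative p) := by
  have hcl : closure (interior K) = K := by
    rw [hK.2.1.closure_interior_eq_closure_of_nonempty_interior hK.2.2, hK.1.isClosed.closure_eq]
  obtain ⟨w, hw, hmax⟩ := Complex.exists_mem_frontier_isMaxOn_norm (f := fun w => p.eval w)
    (hK.1.isBounded.subset interior_subset) hK.2.2 p.differentiable.diffContOnCl
  rw [hcl] at hmax
  have hwK : w ∈ frontier K := frontier_interior_subset hw
  have hwK' : w ∈ K := hK.1.isClosed.frontier_subset hwK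
  have hsup : supNormOn K p = ‖p.eval w‖ := by
    refine le_antisymm (csSup_le ⟨_, mem_image_of_mem _ hwK'⟩ ?_)
      (le_csSup (bddAbove_norm_eval hK.1 p) (mem_image_of_mem _ hwK'))
    rintro _ ⟨x, hx, rfl⟩
    exact hmax hx
  obtain ⟨c, hc, hd⟩ := h.exists_disc hK hz hκ hwK
  have h1 := natDegree_mul_norm_eval_le hc fun r hr => hd r (hp.2 r hr)
  rw [natDegree_eq_of_degree_eq_some hp.1, inv_mul_eq_div, le_div_iff₀' hκ] at h1
  rw [hsup]
  refine le_trans (le_of_eq ?_) (h1.trans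
    (le_csSup (bddAbove_norm_eval hK.1 (derivative p)) (mem_image_of_mem _ hwK')))
  ring

end

theorem mainTheorem2 (K : Set ℂ) (hK : IsConvexDomain K) (z : ℂ) (hz : z ∈ interior K)
    (κ : ℝ) (hκ : 0 < κ) :
    List.TFAE [CurvatureGeAE K z κ, CurvatureRadiusLeAE K z κ,
      AngleIncrementGe K z κ, SubdifferentialCondition K z κ] ∧
    ((CurvatureGeAE K z κ ∨ CurvatureRadiusLeAE K z κ ∨
        AngleIncrementGe K z κ ∨ SubdifferentialCondition K z κ) →
      ∀ (n : ℕ), ∀ p ∈ polynomialsWithZerosIn n K,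
        κ / 2 * (n : ℝ) * supNormOn K p ≤ supNormOn K (Polynomial.derivative p)) := by
  have htfae := tfae_curvature_conditions hK hz hκ
  refine ⟨htfae, fun hor n p hp => ?_⟩
  have h14 := htfae.out 0 3
  have h24 := htfae.out 1 3
  have h34 := htfae.out 2 3
  have h4 : SubdifferentialCondition K z κ := by
    rcases hor with h | h | h | h
    exacts [h14.1 h, h24.1 h, h34.1 h, h]
  exact h4.mul_supNormOn_le hK hz hκ hp
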